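/- Let $k\ge 1$ be an integer, let $f:[0,k]\to\mathbb R$ be convex and non-decreasing with $f(0)=0$, put $c_i=f(i)-f(i-1)$ for $1\le i\le k$, and let $p_{\max}\ge p_{\min}>c_k$. Buyers $1,\dots,T$ arrive one at a time ($T$ unknown in advance); buyer $t$ offers a price $p_t\in[p_{\min},p_{\max}]$ and must be irrevocably accepted ($x_t=1$) or rejected ($x_t=0$) on the basis of $p_1,\dots,p_t$ (and of internal randomness) only, subject to $\sum_t x_t\le k$. The profit is $\sum_t p_tx_t-f(\sum_t x_t)$. For an instance $\mathcal I=(p_1,\dots,p_T)$ let $\mathrm{OPT}(\mathcal I)$ be the largest profit of a selection of at most $k$ buyers, and call a (possibly randomized) online algorithm $\alpha$-competitive if $\mathrm{OPT}(\mathcal I)\le\alpha\,\mathbb E[\mathrm{ALG}(\mathcal I)]$ for every instance $\mathcal I$. For $\gamma\in(0,k]$ put $$F(\gamma)=\frac{p_{\min}k-f(k)}{p_{\min}\gamma-f(\gamma)} ,$$ and consider the equation $$\frac{p_{\max}}{\exp(F(\gamma))}-\frac{p_{\min}}{\exp(\gamma F(\gamma)/k)}=-\int_{\gamma}^{k}\frac{F(\gamma)f'(y)}{k\exp(yF(\gamma)/k)}\,dy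 ,\qquad \gamma\in(0,k], \tag{1}$$ where $f'$ is the derivative of $f$, which exists at all but countably many points of $(0,k)$. Then: 1. Equation (1) has a root in $(0,k]$. The root is unique if $p_{\max}>p_{\min}$, and also if $p_{\max}=p_{\min}$ and $y\mapsto p_{\min}y-f(y)$ is strictly increasing on $[0,k]$. 2. If $\gamma^{(1)}\in(0,k]$ is a root of (1), then for every $\varepsilon>0$ no online algorithm, deterministic or randomized, is $(F(\gamma^{(1)})-\varepsilon)$-competitive. -/

import Mathlib

open MeasureTheory

/-- Profit from an arrival instance `I` (the list of the offered prices, in order of arrival) when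
exactly the buyers in `S` are selected: revenue minus the cost `f` of producing `|S|` units. -/
def profit (f : ℝ → ℝ) (I : List ℝ) (S : Finset (Fin I.length)) : ℝ :=
  ∑ t ∈ S, I.get t - f (S.card : ℝ)

/-- The feasible selections: sets of at most `k` buyers. -/
def feasible (k : ℕ) (I : List ℝ) : Finset (Finset (Fin I.length)) :=
  Finset.univ.filter fun S => S.card ≤ k

theorem feasible_nonempty (k : ℕ) (I : List ℝ) : (feasible k I).Nonempty :=
  ⟨∅, by simp [feasible]⟩

/-- The optimal offline profit `OPT(I)`. -/
noncomputable def offlineOpt (f : ℝ → ℝ) (k : ℕ) (I : List ℝ) : ℝ :=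
  (feasible k I).sup' (feasible_nonempty k I) (profit f I)

/-- Arrival instances all of whose prices lie in `[pmin, pmax]`. -/
def IsInstance (pmin pmax : ℝ) (I : List ℝ) : Prop :=
  ∀ p ∈ I, p ∈ Set.Icc pmin pmax

/-- The set of buyers of `I` selected by a decision rule `accept`, which maps the list of the
prices seen so far (current price last) to the irrevocable decision about the current buyer. -/
def selectedBy (accept : List ℝ → Bool) (I : List ℝ) : Finset (Fin I.length) :=
  Finset.univ.filter fun t => accept (I.take (t.val + 1)) = true

/-- A deterministic online algorithm for capacity `k` and price range `[pmin, pmax]`: a decision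
rule that never selects more than `k` buyers. -/
structure OnlineAlgorithm (k : ℕ) (pmin pmax : ℝ) where
  accept : List ℝ → Bool
  capacity : ∀ I : List ℝ, IsInstance pmin pmax I → (selectedBy accept I).card ≤ k

/-- A randomized online algorithm over the sample space `Ω`: a random deterministic online
algorithm, each of whose decisions is a random variable. (Deterministic algorithms are the
constant ones.) -/
structure RandomizedAlgorithm (Ω : Type*) [MeasurableSpace Ω] (k : ℕ) (pmin pmax : ℝ) where
  alg : Ω → OnlineAlgorithm k pmin pmax
  measurable_accept : ∀ h : List ℝ, Measurable fun ω => (alg ω).accept h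

/-- The expected profit `𝔼[ALG(I)]`. -/
noncomputable def RandomizedAlgorithm.expectedProfit {Ω : Type*} [MeasurableSpace Ω] {k : ℕ}
    {pmin pmax : ℝ} (A : RandomizedAlgorithm Ω k pmin pmax) (μ : Measure Ω) (f : ℝ → ℝ)
    (I : List ℝ) : ℝ :=
  ∫ ω, profit f I (selectedBy (A.alg ω).accept I) ∂μ

/-- `A` is `α`-competitive: `OPT(I) ≤ α · 𝔼[ALG(I)]` for every arrival instance `I`. -/
def RandomizedAlgorithm.IsCompetitive {Ω : Type*} [MeasurableSpace Ω] {k : ℕ}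
    {pmin pmax : ℝ} (A : RandomizedAlgorithm Ω k pmin pmax) (μ : Measure Ω) (f : ℝ → ℝ)
    (α : ℝ) : Prop :=
  ∀ I : List ℝ, IsInstance pmin pmax I → offlineOpt f k I ≤ α * A.expectedProfit μ f I

/-- The marginal cost `c_i = f(i) - f(i-1)` of the `i`-th unit. -/
def marginalCost (f : ℝ → ℝ) (i : ℕ) : ℝ := f (i : ℝ) - f ((i : ℝ) - 1)

/-- `F(γ) = (pmin k - f(k)) / (pmin γ - f(γ))`. -/
noncomputable def lowerBoundF (f : ℝ → ℝ) (pmin : ℝ) (k : ℕ) (γ : ℝ) : ℝ :=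
  (pmin * k - f k) / (pmin * γ - f γ)

/-- `γ ∈ (0, k]` solves the characteristic equation. The derivative of the convex function `f`
exists at all but countably many points of `(0, k)`, so the integral does not depend on the
value given to `deriv f` at the other points. -/
def IsGammaRoot (f : ℝ → ℝ) (pmin pmax : ℝ) (k : ℕ) (γ : ℝ) : Prop :=
  γ ∈ Set.Ioc (0 : ℝ) k ∧
    pmax / Real.exp (lowerBoundF f pmin k γ)
        - pmin / Real.exp (γ * lowerBoundF f pmin k γ / k)
      = - ∫ y in γ..(k : ℝ),
          lowerBoundF f pmin k γ * deriv f y / (k * Real.exp (y * lowerBoundF f pmin k γ / k))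

/-! Write g(y) = pmin·y − f(y), A = g(k), c = A/k, D = pmax − pmin, and let λ be the competitive
ratio divided by k.

Lower bound. Offer prices rising from pmin to pmax in steps of δ, each price k times. At price pmin
+ q let w be the expected sales and R the expected revenue in excess of pmin. The instance may stop
there and the optimum is at least (pmin + q)k − f(k), so competitiveness gives c + q ≤ λ(R + G(w)).
Here G is the interpolation of g at the integers: sales are integers, and Jensen's inequality passes
to their mean. As δ → 0 we have dR = q dw, hence dR/dw ≤ λR + (λG − c), and Gronwall bounds R. At q
= D this bounds D by an expression strictly increasing in λ (`RandomizedAlgorithm.price_range_le`).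
At ν = F(γ)/k one has ν·g(γ) = c, so the positive part of νG − c vanishes before γ; on the rest G ≤
g, and equation (1), integrated by parts, says that the bound is at most D. A ratio with λ < ν would
therefore give D < D.

Roots. With σ = pmin − f', equation (1) reads D = ν ∫_γ^k σ(y) exp(ν(k − y)) dy, where ν = F(γ)/k.
The right side, integrated by parts, is continuous in γ, is 0 at γ = k and at least D for some small
γ, whence a root. If D > 0, moving left from a root raises ν and lengthens the tail; since σ is
antitone the integral does not drop (`tail_integral_mono`), so there is no second root.

Convexity allows f to jump at k, so the analysis runs on a continuous φ that agrees with f on (0,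
k). -/

/-- The line through the points of the graph of `g` at `i - 1` and `i`. -/
def chordLine (g : ℝ → ℝ) (i : ℕ) (y : ℝ) : ℝ := g i + (y - i) * (g i - g ((i : ℝ) - 1))

/-- The smallest of the chord lines of `g` over the unit intervals `[i - 1, i]`, `1 ≤ i ≤ k`. For
concave `g` this is the piecewise linear interpolation of `g` at the integers. -/
noncomputable def chordMin (g : ℝ → ℝ) (k : ℕ) (hk : 1 ≤ k) (y : ℝ) : ℝ :=
  (Finset.Icc 1 k).inf' (Finset.nonempty_Icc.2 hk) fun i => chordLine g i y

/-! ### Concave functions and their interpolation at the integers -/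

section Chords

variable {g : ℝ → ℝ} {k : ℕ}

/-- A division-free form of concavity, which stays valid when points coincide. -/
theorem ConcaveOn.three_point {s : Set ℝ} (hg : ConcaveOn ℝ s g) {x y z : ℝ} (hx : x ∈ s)
    (hz : z ∈ s) (hxy : x ≤ y) (hyz : y ≤ z) :
    (z - y) * g x + (y - x) * g z ≤ (z - x) * g y := by
  rcases hxy.eq_or_lt with rfl | hxy
  · simp
  rcases hyz.eq_or_lt with rfl | hyz
  · simp
  have := hg.neg.secant_mono_aux1 hx hz hxy hyz
  simp only [Pi.neg_apply] at this
  linarith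

theorem ConcaveOn.le_of_le_right {s : Set ℝ} (hg : ConcaveOn ℝ s g) {x y z : ℝ} (hx : x ∈ s)
    (hz : z ∈ s) (hxy : x ≤ y) (hyz : y ≤ z) (h : g x ≤ g z) : g x ≤ g y := by
  rcases hxy.eq_or_lt with rfl | hxy
  · exact le_rfl
  have h3 := hg.three_point hx hz hxy.le hyz
  by_contra! hlt
  nlinarith [mul_nonneg (sub_nonneg.2 hxy.le) (sub_nonneg.2 h),
    mul_pos (sub_pos.2 (hxy.trans_le hyz)) (sub_pos.2 hlt)]

/-- Left of a point that lies below a later one, a concave function stays below. -/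
theorem ConcaveOn.lt_of_lt_later {s : Set ℝ} (hg : ConcaveOn ℝ s g) {x y z : ℝ} (hx : x ∈ s)
    (hz : z ∈ s) (hxy : x < y) (hyz : y < z) (h : g y < g z) : g x < g y := by
  have h3 := hg.three_point hx hz hxy.le hyz.le
  by_contra! hlt
  nlinarith [mul_pos (sub_pos.2 hxy) (sub_pos.2 h), mul_nonneg (sub_pos.2 hyz).le (sub_nonneg.2 hlt)]

theorem natCast_mem_Icc {i : ℕ} (hi : i ≤ k) : (i : ℝ) ∈ Set.Icc (0 : ℝ) k :=
  ⟨by positivity, by exact_mod_cast hi⟩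

theorem natCast_sub_one_mem_Icc {i : ℕ} (hi1 : 1 ≤ i) (hi : i ≤ k) :
    (i : ℝ) - 1 ∈ Set.Icc (0 : ℝ) k := by
  have h1 : (1 : ℝ) ≤ i := by exact_mod_cast hi1
  have h2 : (i : ℝ) ≤ k := by exact_mod_cast hi
  exact ⟨by linarith, by linarith⟩

/-- A concave graph lies below its chord lines outside the chord's interval, and no integer lies
strictly between i − 1 and i. -/
theorem le_chordLine (hg : ConcaveOn ℝ (Set.Icc (0 : ℝ) k) g) {i n : ℕ} (hi1 : 1 ≤ i) (hi : i ≤ k)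
    (hn : n ≤ k) : g n ≤ chordLine g i n := by
  have mi := natCast_mem_Icc hi
  have mi' := natCast_sub_one_mem_Icc hi1 hi
  have mn := natCast_mem_Icc hn
  unfold chordLine
  rcases le_or_gt i n with h | h
  · have h' : (i : ℝ) ≤ n := by exact_mod_cast h
    linarith [hg.three_point mi' mn (y := i) (by linarith) h']
  · have h' : (n : ℝ) ≤ (i : ℝ) - 1 := by
      have : (n : ℝ) + 1 ≤ i := by exact_mod_cast h
      linarith
    linarith [hg.three_point mn mi h' (by linarith)]

theorem chordLine_le (hg : ConcaveOn ℝ (Set.Icc (0 : ℝ) k) g) {i : ℕ} (hi1 : 1 ≤ i) (hi : i ≤ k)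
    {y : ℝ} (h1 : (i : ℝ) - 1 ≤ y) (h2 : y ≤ i) : chordLine g i y ≤ g y := by
  have := hg.three_point (natCast_sub_one_mem_Icc hi1 hi) (natCast_mem_Icc hi) h1 h2
  unfold chordLine
  linarith

/-- Increments of a concave function decrease, so a positive last one makes all positive. Hence the
interpolation is increasing even where g itself is not. -/
theorem chord_increment_pos (hg : ConcaveOn ℝ (Set.Icc (0 : ℝ) k) g) (hlast : g ((k : ℝ) - 1) < g k)
    {i : ℕ} (hi1 : 1 ≤ i) (hi : i ≤ k) : 0 < g i - g ((i : ℝ) - 1) := by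
  rcases hi.eq_or_lt with rfl | hlt
  · linarith
  have h' : (i : ℝ) ≤ (k : ℝ) - 1 := by
    have : (i : ℝ) + 1 ≤ k := by exact_mod_cast hlt
    linarith
  have hk1 : 1 ≤ k := hi1.trans hi
  have a : g i < g k := by
    rcases h'.eq_or_lt with h | h
    · rwa [h]
    · exact (hg.lt_of_lt_later (natCast_mem_Icc hi) (natCast_mem_Icc le_rfl) h (by linarith)
        hlast).trans hlast
  have := hg.lt_of_lt_later (natCast_sub_one_mem_Icc hi1 hi) (natCast_mem_Icc le_rfl)
    (y := i) (by linarith) (by linarith) a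
  linarith

theorem continuous_chordMin (hk : 1 ≤ k) : Continuous (chordMin g k hk) := by
  refine Continuous.finset_inf'_apply _ fun i _ => ?_
  unfold chordLine
  fun_prop

theorem monotone_chordMin (hk : 1 ≤ k) (hg : ConcaveOn ℝ (Set.Icc (0 : ℝ) k) g)
    (hlast : g ((k : ℝ) - 1) < g k) : Monotone (chordMin g k hk) := by
  intro x y hxy
  refine Finset.le_inf' _ _ fun i hi => (Finset.inf'_le _ hi).trans ?_
  obtain ⟨h1, h2⟩ := Finset.mem_Icc.1 hi
  have := (chord_increment_pos hg hlast h1 h2).le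
  unfold chordLine
  gcongr

theorem chordMin_le (hk : 1 ≤ k) (hg : ConcaveOn ℝ (Set.Icc (0 : ℝ) k) g) {y : ℝ}
    (hy : y ∈ Set.Icc (0 : ℝ) k) : chordMin g k hk y ≤ g y := by
  obtain ⟨i, h1, h2, h3, h4⟩ : ∃ i : ℕ, 1 ≤ i ∧ i ≤ k ∧ (i : ℝ) - 1 ≤ y ∧ y ≤ i := by
    rcases hy.1.eq_or_lt with rfl | h0
    · exact ⟨1, le_rfl, hk, by simp, by simp⟩
    · refine ⟨⌈y⌉₊, Nat.one_le_ceil_iff.2 h0, Nat.ceil_le.2 hy.2, ?_, Nat.le_ceil y⟩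
      linarith [Nat.ceil_lt_add_one hy.1]
  exact (Finset.inf'_le _ (Finset.mem_Icc.2 ⟨h1, h2⟩)).trans (chordLine_le hg h1 h2 h3 h4)

theorem le_chordMin (hk : 1 ≤ k) (hg : ConcaveOn ℝ (Set.Icc (0 : ℝ) k) g) {n : ℕ} (hn : n ≤ k) :
    g n ≤ chordMin g k hk n :=
  Finset.le_inf' _ _ fun _ hi => le_chordLine hg (Finset.mem_Icc.1 hi).1 (Finset.mem_Icc.1 hi).2 hn

/-- Jensen's inequality for integer-valued random variables. -/
theorem integral_le_chordMin (hk : 1 ≤ k) (hg : ConcaveOn ℝ (Set.Icc (0 : ℝ) k) g) {Ω : Type*}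
    [MeasurableSpace Ω] (μ : Measure Ω) [IsProbabilityMeasure μ] (N : Ω → ℕ) (hN : ∀ ω, N ω ≤ k)
    (hi : Integrable (fun ω => (N ω : ℝ)) μ) (hgi : Integrable (fun ω => g (N ω)) μ) :
    ∫ ω, g (N ω) ∂μ ≤ chordMin g k hk (∫ ω, (N ω : ℝ) ∂μ) := by
  refine Finset.le_inf' _ _ fun i hi' => ?_
  obtain ⟨h1, h2⟩ := Finset.mem_Icc.1 hi'
  have hd : Integrable (fun ω => (N ω : ℝ) - i) μ := hi.sub (integrable_const _)
  calc ∫ ω, g (N ω) ∂μ ≤ ∫ ω, chordLine g i (N ω) ∂μ :=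
        integral_mono hgi ((integrable_const _).add (hd.mul_const _))
          fun ω => le_chordLine hg h1 h2 (hN ω)
    _ = chordLine g i (∫ ω, (N ω : ℝ) ∂μ) := by
        unfold chordLine
        rw [integral_add (integrable_const _) (hd.mul_const _), integral_mul_const,
          integral_sub hi (integrable_const _)]
        simp

end Chords

/-! ### Discrete Gronwall inequality -/

section Gronwall

open intervalIntegral

/-- Integrated form of a linear differential inequality on one step. -/
theorem exp_mul_sub_le_integral {lam a b R q : ℝ} (hab : a ≤ b) {β : ℝ → ℝ} (hβ : Continuous β)
    (h : ∀ y ∈ Set.Icc a b, q ≤ lam * (R + q * (y - a)) + β y) :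
    Real.exp (-lam * b) * (R + q * (b - a)) - Real.exp (-lam * a) * R
      ≤ ∫ y in a..b, Real.exp (-lam * y) * β y := by
  have hd : ∀ y, HasDerivAt (fun y => Real.exp (-lam * y) * (R + q * (y - a)))
      (Real.exp (-lam * y) * (q - lam * (R + q * (y - a)))) y := by
    intro y
    have h1 : HasDerivAt (fun y => Real.exp (-lam * y)) (Real.exp (-lam * y) * (-lam * 1)) y :=
      ((hasDerivAt_id y).const_mul (-lam)).exp
    have h2 : HasDerivAt (fun y => R + q * (y - a)) (q * 1) y :=
      (((hasDerivAt_id y).sub_const a).const_mul q).const_add R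
    refine (h1.mul h2).congr_deriv ?_
    ring
  have hc : Continuous fun y => Real.exp (-lam * y) * (q - lam * (R + q * (y - a))) := by fun_prop
  have := integral_eq_sub_of_hasDerivAt (fun y _ => hd y) (hc.intervalIntegrable a b)
  simp only [sub_self, mul_zero, add_zero] at this
  rw [← this]
  refine integral_mono_on hab (hc.intervalIntegrable _ _)
    (Continuous.intervalIntegrable (by fun_prop) _ _) fun y hy => ?_
  have := h y hy
  gcongr
  linarith

/-- A discrete Gronwall inequality: `w` is the amount sold and `q` the price level. -/
theorem exp_mul_le_integral_of_discrete {lam δ c : ℝ} (hlam : 0 < lam) (hδ : 0 ≤ δ) {G : ℝ → ℝ}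
    (hG : Continuous G) (hGm : Monotone G) {w R : ℕ → ℝ} {n : ℕ} (hw0 : 0 ≤ w 0) (hw : Monotone w)
    (hR0 : R 0 = 0) (hR : ∀ j, R (j + 1) = R j + δ * (j + 1 : ℕ) * (w (j + 1) - w j))
    (hq : ∀ j < n, c + δ * j ≤ lam * (R j + G (w j))) :
    ∀ j ≤ n, Real.exp (-lam * w j) * R j
      ≤ ∫ y in 0..w j, Real.exp (-lam * y) * (max (lam * G y - c) 0 + δ) := by
  have hβ : Continuous fun y => max (lam * G y - c) 0 + δ := by fun_prop
  have hint : ∀ a b, IntervalIntegrable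
      (fun y => Real.exp (-lam * y) * (max (lam * G y - c) 0 + δ)) volume a b :=
    fun a b => Continuous.intervalIntegrable (by fun_prop) a b
  intro j
  induction j with
  | zero =>
    -- Sales at the floor price leave R at 0 while w 0 may be positive; the truncation at 0 keeps
    -- the integral nonnegative.
    intro _
    rw [hR0, mul_zero]
    exact integral_nonneg hw0 fun y _ => by positivity
  | succ j ih =>
    intro hj
    have hstep := hw (Nat.le_succ j)
    rw [← integral_add_adjacent_intervals (hint 0 (w j)) (hint _ (w (j + 1)))]
    -- Units of this step sell at level δ(j + 1), but the constraint available is the one at level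
    -- δj; the summand δ in the integrand pays the difference.
    have := exp_mul_sub_le_integral (lam := lam) (R := R j) (q := δ * (j + 1 : ℕ)) hstep hβ
      fun y hy => by
        have h1 := hq j (by omega)
        have h2 : lam * G (w j) ≤ lam * G y := by have := hGm hy.1; gcongr
        have h3 := le_max_left (lam * G y - c) 0
        have h4 : 0 ≤ lam * (δ * (j + 1 : ℕ) * (y - w j)) := by
          have := sub_nonneg.2 hy.1
          positivity
        push_cast at h4 ⊢
        linarith
    rw [← hR] at this
    linarith [ih (by omega)]

end Gronwall

/-! ### Continuous version of f, right derivatives and weighted tail integrals -/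

section Analysis

open Set intervalIntegral Topology Filter

/-- A monotone function that is convex on `[0, k]` agrees on `(0, k)` with a continuous function,
which is not larger at `k`. -/
theorem exists_continuous_eqOn_Ioo {f : ℝ → ℝ} {b : ℝ} (hb : 0 < b)
    (hconv : ConvexOn ℝ (Icc 0 b) f) (hmono : MonotoneOn f (Icc 0 b)) :
    ∃ φ : ℝ → ℝ, Continuous φ ∧ EqOn φ f (Ioo 0 b) ∧ φ b ≤ f b := by
  have hcont : ContinuousOn f (Ioo 0 b) := by
    have := hconv.continuousOn_interior
    rwa [interior_Icc] at this
  set h : ℝ → ℝ := IccExtend hb.le ((Icc 0 b).domRestrict f) with hh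
  have hm : Monotone h := Monotone.IccExtend _ fun x y hxy => hmono x.2 y.2 hxy
  have he : EqOn h f (Icc 0 b) := fun x hx => by rw [hh, IccExtend_of_mem _ _ hx]; rfl
  have hcont' : ContinuousOn h (Ioo 0 b) := hcont.congr (he.mono Ioo_subset_Icc_self)
  have hl := hm.tendsto_nhdsLT b
  set e := extendFrom (Ioo 0 b) h with hedef
  have hec : ContinuousOn e (Icc 0 b) :=
    continuousOn_Icc_extendFrom_Ioo hcont' (hm.tendsto_nhdsGT 0) hl
  refine ⟨IccExtend hb.le ((Icc 0 b).domRestrict e), hec.domRestrict.Icc_extend', fun x hx => ?_, ?_⟩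
  · rw [IccExtend_of_mem _ _ (Ioo_subset_Icc_self hx), domRestrict_apply]
    rw [hedef, extendFrom_extends hcont' _ hx]
    exact he (Ioo_subset_Icc_self hx)
  · rw [IccExtend_of_mem _ _ (right_mem_Icc.2 hb.le), domRestrict_apply, hedef,
      eq_lim_at_right_extendFrom_Ioo hb hl, ← he (right_mem_Icc.2 hb.le)]
    refine csSup_le (nonempty_Iio.image _) ?_
    rintro _ ⟨x, hx, rfl⟩
    exact hm (le_of_lt hx)

/-- The margin `pmin - f'`, in terms of the right derivative of `f`. -/
noncomputable def margin (f : ℝ → ℝ) (pmin y : ℝ) : ℝ := pmin - derivWithin f (Ioi y) y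

/-- The derivative of f may be unbounded near b; it is integrable because it is a nonnegative right
derivative of a continuous function. -/
theorem intervalIntegrable_margin {f φ : ℝ → ℝ} {b pmin a : ℝ}
    (hconv : ConvexOn ℝ (Icc 0 b) f) (hmono : MonotoneOn f (Icc 0 b)) (hφ : Continuous φ)
    (hφf : EqOn φ f (Ioo 0 b)) (ha : 0 < a) (hab : a ≤ b) :
    (∀ y ∈ Ioo a b, HasDerivWithinAt (fun y => pmin * y - φ y) (margin f pmin y) (Ioi y) y) ∧
      IntervalIntegrable (margin f pmin) volume a b := by
  have hd : ∀ y ∈ Ioo a b, HasDerivWithinAt φ (derivWithin f (Ioi y) y) (Ioi y) y := by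
    intro y hy
    have hy' : y ∈ Ioo 0 b := ⟨ha.trans hy.1, hy.2⟩
    have h1 := hconv.hasDerivWithinAt_rightDeriv_of_mem_interior (x := y) (by rwa [interior_Icc])
    refine h1.congr_of_eventuallyEq ?_ (hφf hy')
    exact mem_nhdsWithin_of_mem_nhds
      (Filter.mem_of_superset (isOpen_Ioo.mem_nhds hy') fun z hz => hφf hz)
  refine ⟨fun y hy => ?_, ?_⟩
  · have h2 : HasDerivWithinAt (fun y => pmin * y) pmin (Ioi y) y := by
      simpa using ((hasDerivAt_id y).const_mul pmin).hasDerivWithinAt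
    exact h2.sub (hd y hy)
  · refine IntervalIntegrable.sub intervalIntegrable_const ?_
    rw [intervalIntegrable_iff_integrableOn_Ioc_of_le hab]
    refine integrableOn_deriv_right_of_nonneg hφ.continuousOn hd fun y hy => ?_
    have hm : MonotoneOn f (Icc y b) := hmono.mono (Icc_subset_Icc_left (ha.trans hy.1).le)
    -- Derivatives within [y, b] are nonnegative by monotonicity there, and to the right of y the
    -- two sets agree locally.
    have : derivWithin f (Ioi y) y = derivWithin f (Icc y b) y := by
      rw [derivWithin_Ioi_eq_Ici]
      exact (derivWithin_inter (Iic_mem_nhds hy.2)).symm.trans (by rw [Ici_inter_Iic])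
    rw [this]
    exact hm.derivWithin_nonneg

/-- Integration by parts against an exponential. -/
theorem integral_rightDeriv_mul_exp {G σ : ℝ → ℝ} {a b lam : ℝ} (hab : a ≤ b) (hG : Continuous G)
    (hd : ∀ y ∈ Ioo a b, HasDerivWithinAt G (σ y) (Ioi y) y)
    (hσ : IntervalIntegrable σ volume a b) :
    ∫ y in a..b, σ y * Real.exp (lam * (b - y))
      = G b - G a + lam * ∫ y in a..b, (G y - G a) * Real.exp (lam * (b - y)) := by
  have hσe : IntervalIntegrable (fun y => σ y * Real.exp (lam * (b - y))) volume a b :=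
    hσ.mul_continuousOn (by fun_prop)
  have hGe : IntervalIntegrable (fun y => lam * ((G y - G a) * Real.exp (lam * (b - y))))
      volume a b := Continuous.intervalIntegrable (by fun_prop) a b
  have hder : ∀ y ∈ Ioo a b, HasDerivWithinAt (fun y => (G y - G a) * Real.exp (lam * (b - y)))
      (σ y * Real.exp (lam * (b - y)) - lam * ((G y - G a) * Real.exp (lam * (b - y))))
      (Ioi y) y := by
    intro y hy
    have h1 : HasDerivAt (fun y => Real.exp (lam * (b - y)))
        (Real.exp (lam * (b - y)) * (lam * (-1))) y :=
      (((hasDerivAt_id y).const_sub b).const_mul lam).exp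
    refine (((hd y hy).sub_const (G a)).mul h1.hasDerivWithinAt).congr_deriv ?_
    ring
  have := integral_eq_sub_of_hasDeriv_right_of_le hab
    (Continuous.continuousOn (by fun_prop)) hder (hσe.sub hGe)
  rw [integral_sub hσe hGe, intervalIntegral.integral_const_mul] at this
  simp only [sub_self, mul_zero, Real.exp_zero, mul_one, zero_mul, sub_zero] at this
  linarith

/-- For an antitone `σ`, the exponentially weighted tail integral of `σ` grows when the weight gets
steeper and the tail longer, as soon as it is positive. -/
theorem tail_integral_mono {σ : ℝ → ℝ} {a₁ a₂ b lam₁ lam₂ : ℝ} (ha₁ : 0 < a₁) (ha : a₁ < a₂)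
    (hb : a₂ < b) (hlam : lam₂ ≤ lam₁) (hσ : AntitoneOn σ (Ioo 0 b))
    (hint : IntervalIntegrable σ volume a₁ b)
    (hpos : 0 < ∫ y in a₂..b, σ y * Real.exp (lam₂ * (b - y))) :
    ∫ y in a₂..b, σ y * Real.exp (lam₂ * (b - y))
      ≤ ∫ y in a₁..b, σ y * Real.exp (lam₁ * (b - y)) := by
  have hi : ∀ lam : ℝ, IntervalIntegrable (fun y => σ y * Real.exp (lam * (b - y))) volume a₁ b :=
    fun lam => hint.mul_continuousOn (by fun_prop)
  have h12 : uIcc a₁ a₂ ⊆ uIcc a₁ b := by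
    rw [uIcc_of_le ha.le, uIcc_of_le (ha.trans hb).le]; exact Icc_subset_Icc_right hb.le
  have h2b : uIcc a₂ b ⊆ uIcc a₁ b := by
    rw [uIcc_of_le hb.le, uIcc_of_le (ha.trans hb).le]; exact Icc_subset_Icc_left ha.le
  obtain ⟨y₀, hy₀, hσy₀⟩ : ∃ y ∈ Ioo a₂ b, 0 < σ y := by
    by_contra! hcon
    have : ∫ y in a₂..b, σ y * Real.exp (lam₂ * (b - y)) ≤ ∫ _ in a₂..b, (0 : ℝ) :=
      integral_mono_on_of_le_Ioo hb.le ((hi lam₂).mono_set h2b) intervalIntegrable_const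
        fun y hy => mul_nonpos_of_nonpos_of_nonneg (hcon y hy) (Real.exp_pos _).le
    rw [intervalIntegral.integral_zero] at this
    linarith
  set S := {y | y ∈ Ioo 0 b ∧ 0 < σ y} with hS
  have hy₀S : y₀ ∈ S := ⟨⟨(ha₁.trans ha).trans hy₀.1, hy₀.2⟩, hσy₀⟩
  have hbdd : BddAbove S := ⟨b, fun y hy => hy.1.2.le⟩
  -- The point where σ changes sign from nonnegative to nonpositive.
  set m := sSup S with hm
  have hm₀ : y₀ ≤ m := le_csSup hbdd hy₀S
  have hmb : m ≤ b := csSup_le ⟨y₀, hy₀S⟩ fun y hy => hy.1.2.le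
  have hbelow : ∀ y, 0 < y → y < m → 0 ≤ σ y := by
    intro y hy hym
    obtain ⟨z, hz, hyz⟩ := exists_lt_of_lt_csSup ⟨y₀, hy₀S⟩ hym
    exact hz.2.le.trans (hσ ⟨hy, hyz.trans hz.1.2⟩ hz.1 hyz.le)
  have habove : ∀ y, y < b → m < y → σ y ≤ 0 := by
    intro y hy hym
    by_contra! hpos
    exact absurd (le_csSup hbdd (show y ∈ S from
      ⟨⟨(hy₀S.1.1.trans_le hm₀).trans hym, hy⟩, hpos⟩)) (not_le.2 hym)
  rw [← integral_add_adjacent_intervals ((hi lam₁).mono_set h12) ((hi lam₁).mono_set h2b)]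
  have hfirst : 0 ≤ ∫ y in a₁..a₂, σ y * Real.exp (lam₁ * (b - y)) :=
    integral_nonneg ha.le fun y hy => mul_nonneg
      (hbelow y (ha₁.trans_le hy.1) ((hy.2.trans_lt hy₀.1).trans_le hm₀)) (Real.exp_pos _).le
  -- exp μ is the ratio of the two weights at m. Left of m the ratio is larger and σ ≥ 0, right of m
  -- it is smaller and σ ≤ 0, so replacing it by exp μ only lowers the integral.
  set μ := (lam₁ - lam₂) * (b - m) with hμ
  have hμ0 : 0 ≤ μ := mul_nonneg (sub_nonneg.2 hlam) (sub_nonneg.2 hmb)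
  have hsecond : ∫ y in a₂..b, Real.exp μ * (σ y * Real.exp (lam₂ * (b - y)))
      ≤ ∫ y in a₂..b, σ y * Real.exp (lam₁ * (b - y)) := by
    refine integral_mono_on_of_le_Ioo hb.le (((hi lam₂).mono_set h2b).const_mul _)
      ((hi lam₁).mono_set h2b) fun y hy => ?_
    have hexp : Real.exp μ * (σ y * Real.exp (lam₂ * (b - y)))
        = σ y * Real.exp (μ + lam₂ * (b - y)) := by rw [Real.exp_add]; ring
    rw [hexp]
    rcases le_or_gt y m with hym | hym
    · have hle : μ + lam₂ * (b - y) ≤ lam₁ * (b - y) := by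
        nlinarith [mul_nonneg (sub_nonneg.2 hlam) (sub_nonneg.2 hym)]
      rcases hym.eq_or_lt with rfl | hym
      · have : μ + lam₂ * (b - m) = lam₁ * (b - m) := by rw [hμ]; ring
        rw [this]
      · exact mul_le_mul_of_nonneg_left (Real.exp_le_exp.2 hle)
          (hbelow y ((ha₁.trans ha).trans hy.1) hym)
    · have hle : lam₁ * (b - y) ≤ μ + lam₂ * (b - y) := by
        nlinarith [mul_nonneg (sub_nonneg.2 hlam) (sub_nonneg.2 hym.le)]
      exact mul_le_mul_of_nonpos_left (Real.exp_le_exp.2 hle) (habove y hy.2 hym)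
  rw [intervalIntegral.integral_const_mul] at hsecond
  have := Real.one_le_exp hμ0
  nlinarith

end Analysis

/-! ### Roots of the characteristic equation -/

section CharacteristicEquation

open Set intervalIntegral Topology Filter

variable {f : ℝ → ℝ} {pmin pmax : ℝ} {k : ℕ}

theorem concaveOn_mul_sub (hconv : ConvexOn ℝ (Icc (0 : ℝ) k) f) :
    ConcaveOn ℝ (Icc (0 : ℝ) k) fun y => pmin * y - f y := by
  refine ConcaveOn.sub ⟨convex_Icc _ _, fun x _ y _ a b _ _ _ => ?_⟩ hconv
  simp only [smul_eq_mul]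
  exact le_of_eq (by ring)

theorem last_increment_pos (hhigh : marginalCost f k < pmin) :
    pmin * ((k : ℝ) - 1) - f ((k : ℝ) - 1) < pmin * k - f k := by
  unfold marginalCost at hhigh
  linarith

theorem mul_sub_pos (hk : 1 ≤ k) (hconv : ConvexOn ℝ (Icc (0 : ℝ) k) f) (hf0 : f 0 = 0)
    (hhigh : marginalCost f k < pmin) {y : ℝ} (hy : y ∈ Ioc (0 : ℝ) k) : 0 < pmin * y - f y := by
  have hg := concaveOn_mul_sub (pmin := pmin) hconv
  have hk1 : (1 : ℝ) ≤ k := by exact_mod_cast hk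
  have h0 : (0 : ℝ) ∈ Icc (0 : ℝ) k := ⟨le_rfl, by linarith⟩
  have hkk : (k : ℝ) ∈ Icc (0 : ℝ) k := ⟨by linarith, le_rfl⟩
  have hA : 0 < pmin * k - f k := by
    have h1 := hg.three_point h0 hkk (y := (k : ℝ) - 1) (by linarith) (by linarith)
    have h2 := mul_lt_mul_of_pos_left (last_increment_pos hhigh) (show (0 : ℝ) < k by linarith)
    simp only [hf0] at h1
    linarith
  have h3 := hg.three_point h0 hkk hy.1.le hy.2
  simp only [hf0, mul_zero, sub_zero, zero_add] at h3
  by_contra! hneg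
  nlinarith [mul_pos hy.1 hA]

theorem lowerBoundF_right (hk : 1 ≤ k) (hconv : ConvexOn ℝ (Icc (0 : ℝ) k) f) (hf0 : f 0 = 0)
    (hhigh : marginalCost f k < pmin) : lowerBoundF f pmin k k = 1 :=
  div_self (mul_sub_pos hk hconv hf0 hhigh ⟨by exact_mod_cast hk, le_rfl⟩).ne'

theorem isGammaRoot_right_iff (hk : 1 ≤ k) (hconv : ConvexOn ℝ (Icc (0 : ℝ) k) f) (hf0 : f 0 = 0)
    (hhigh : marginalCost f k < pmin) : IsGammaRoot f pmin pmax k k ↔ pmin = pmax := by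
  have hk0 : (0 : ℝ) < k := by exact_mod_cast hk
  unfold IsGammaRoot
  rw [lowerBoundF_right hk hconv hf0 hhigh, intervalIntegral.integral_same, mul_one,
    div_self hk0.ne', neg_zero, sub_eq_zero, div_left_inj' (Real.exp_pos 1).ne']
  exact ⟨fun h => h.2.symm, fun h => ⟨⟨hk0, le_rfl⟩, h.symm⟩⟩

/-- Substitute f' = pmin − σ: the pmin part integrates to pmin(exp(−λγ) − exp(−λk)) and cancels the
term at γ; multiplying by exp(λk) leaves this form. -/
theorem isGammaRoot_iff_margin (hconv : ConvexOn ℝ (Icc (0 : ℝ) k) f)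
    (hmono : MonotoneOn f (Icc (0 : ℝ) k)) {γ : ℝ} (hγ : γ ∈ Ioo (0 : ℝ) k) {lam : ℝ}
    (hlam : lam = lowerBoundF f pmin k γ / k) :
    IsGammaRoot f pmin pmax k γ ↔
      pmax - pmin = lam * ∫ y in γ..k, margin f pmin y * Real.exp (lam * (k - y)) := by
  have hk0 : (0 : ℝ) < k := hγ.1.trans hγ.2
  obtain ⟨φ, hφ, hφf, -⟩ := exists_continuous_eqOn_Ioo hk0 hconv hmono
  obtain ⟨-, hint⟩ := intervalIntegrable_margin (pmin := pmin) hconv hmono hφ hφf hγ.1 hγ.2.le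
  have hF : lowerBoundF f pmin k γ = lam * k := by rw [hlam]; field_simp
  have hae : ∫ y in γ..k, lam * k * deriv f y / (k * Real.exp (y * (lam * k) / k))
      = ∫ y in γ..k, lam * ((pmin - margin f pmin y) * Real.exp (-lam * y)) := by
    refine intervalIntegral.integral_congr_ae ?_
    have hne : ∀ᵐ y : ℝ, y ≠ k := measure_eq_zero_iff_ae_notMem.1 (measure_singleton (k : ℝ))
    filter_upwards [hne, hmono.ae_differentiableWithinAt_of_mem] with y hy hd hy'
    rw [uIoc_of_le hγ.2.le] at hy'
    have hyk : y < k := lt_of_le_of_ne hy'.2 hy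
    have hy0 : 0 < y := hγ.1.trans hy'.1
    have hda : DifferentiableAt ℝ f y :=
      (hd ⟨hy0.le, hyk.le⟩).differentiableAt (Icc_mem_nhds hy0 hyk)
    rw [margin, hda.derivWithin (uniqueDiffWithinAt_Ioi y)]
    have : y * (lam * k) / k = lam * y := by field_simp
    rw [this, neg_mul, Real.exp_neg]
    have := (Real.exp_pos (lam * y)).ne'
    field_simp
    ring
  have h1 : IntervalIntegrable (fun y => margin f pmin y * Real.exp (-lam * y)) volume γ k :=
    hint.mul_continuousOn (by fun_prop)
  have h2 : IntervalIntegrable (fun y => pmin * (lam * Real.exp (-lam * y))) volume γ k :=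
    Continuous.intervalIntegrable (by fun_prop) _ _
  have hexp : ∫ y in γ..k, lam * Real.exp (-lam * y)
      = Real.exp (-lam * γ) - Real.exp (-lam * k) := by
    have := integral_eq_sub_of_hasDerivAt (a := γ) (b := k)
      (f := fun y => -Real.exp (-lam * y)) (f' := fun y => lam * Real.exp (-lam * y))
      (fun y _ => (((hasDerivAt_id y).const_mul (-lam)).exp.neg).congr_deriv (by simp; ring))
      (Continuous.intervalIntegrable (by fun_prop) _ _)
    rw [this]; ring
  have hsplit : ∫ y in γ..k, lam * ((pmin - margin f pmin y) * Real.exp (-lam * y))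
      = pmin * (Real.exp (-lam * γ) - Real.exp (-lam * k))
        - lam * ∫ y in γ..k, margin f pmin y * Real.exp (-lam * y) := by
    rw [← hexp, ← intervalIntegral.integral_const_mul, ← intervalIntegral.integral_const_mul,
      ← integral_sub h2 (h1.const_mul lam)]
    congr 1
    ext y
    ring
  have hfac : ∫ y in γ..k, margin f pmin y * Real.exp (lam * (k - y))
      = Real.exp (lam * k) * ∫ y in γ..k, margin f pmin y * Real.exp (-lam * y) := by
    rw [← intervalIntegral.integral_const_mul]
    congr 1
    ext y
    rw [show lam * (k - y) = lam * k + -lam * y by ring, Real.exp_add]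
    ring
  unfold IsGammaRoot
  rw [hF, hae, hsplit, hfac, show γ * (lam * k) / k = lam * γ by field_simp, div_eq_mul_inv,
    div_eq_mul_inv, ← Real.exp_neg, ← Real.exp_neg, ← neg_mul, ← neg_mul]
  have he : Real.exp (lam * k) * Real.exp (-lam * k) = 1 := by
    rw [← Real.exp_add]; simp
  set J := ∫ y in γ..k, margin f pmin y * Real.exp (-lam * y)
  constructor
  · rintro ⟨-, h⟩
    linear_combination Real.exp (lam * k) * h - (pmax - pmin) * he
  · intro h
    refine ⟨⟨hγ.1, hγ.2.le⟩, ?_⟩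
    linear_combination Real.exp (-lam * k) * h + lam * J * he

/-- The characteristic equation without the derivative of `f`; `φ` is a continuous version of `f`.
-/
theorem isGammaRoot_iff_continuous (hconv : ConvexOn ℝ (Icc (0 : ℝ) k) f)
    (hmono : MonotoneOn f (Icc (0 : ℝ) k)) {φ : ℝ → ℝ} (hφ : Continuous φ)
    (hφf : EqOn φ f (Ioo (0 : ℝ) k)) {G : ℝ → ℝ} (hG : G = fun y => pmin * y - φ y) {γ : ℝ}
    (hγ : γ ∈ Ioo (0 : ℝ) k) {lam : ℝ} (hlam : lam = lowerBoundF f pmin k γ / k) :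
    IsGammaRoot f pmin pmax k γ ↔
      pmax - pmin = lam * (G k - G γ + lam * ∫ y in γ..k, (G y - G γ) * Real.exp (lam * (k - y))) := by
  obtain ⟨hd, hint⟩ := intervalIntegrable_margin (pmin := pmin) hconv hmono hφ hφf hγ.1 hγ.2.le
  subst hG
  rw [isGammaRoot_iff_margin hconv hmono hγ hlam,
    integral_rightDeriv_mul_exp hγ.2.le (by fun_prop) hd hint]

/-- Past a point where `pmin y - f y` lies below its final value it stays above its value there. -/
theorem le_of_le_final (hconv : ConvexOn ℝ (Icc (0 : ℝ) k) f) {φ : ℝ → ℝ}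
    (hφf : EqOn φ f (Ioo (0 : ℝ) k)) (hφk : φ k ≤ f k) {γ : ℝ} (hγ : γ ∈ Ioo (0 : ℝ) k)
    (hle : pmin * γ - f γ ≤ pmin * k - f k) :
    ∀ y ∈ Icc γ (k : ℝ), pmin * γ - φ γ ≤ pmin * y - φ y := by
  intro y hy
  rw [hφf hγ]
  rcases hy.2.eq_or_lt with rfl | hyk
  · linarith
  · rw [hφf ⟨hγ.1.trans_le hy.1, hyk⟩]
    exact (concaveOn_mul_sub hconv).le_of_le_right (Ioo_subset_Icc_self hγ)
      (right_mem_Icc.2 (hγ.1.trans hγ.2).le) hy.1 hy.2 hle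

theorem exists_isGammaRoot (hk : 1 ≤ k) (hconv : ConvexOn ℝ (Icc (0 : ℝ) k) f)
    (hmono : MonotoneOn f (Icc (0 : ℝ) k)) (hf0 : f 0 = 0) (hp : pmin ≤ pmax)
    (hhigh : marginalCost f k < pmin) : ∃ γ, IsGammaRoot f pmin pmax k γ := by
  rcases hp.eq_or_lt with heq | hlt
  · exact ⟨k, (isGammaRoot_right_iff hk hconv hf0 hhigh).2 heq⟩
  have hk0 : (0 : ℝ) < k := by exact_mod_cast hk
  have hk1 : (1 : ℝ) ≤ k := by exact_mod_cast hk
  obtain ⟨φ, hφ, hφf, hφk⟩ := exists_continuous_eqOn_Ioo hk0 hconv hmono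
  have hpos := fun y hy => mul_sub_pos (y := y) hk hconv hf0 hhigh hy
  set A := pmin * k - f k with hA
  have hA0 : 0 < A := hpos k ⟨hk0, le_rfl⟩
  set D := pmax - pmin with hD
  have hD0 : 0 < D := sub_pos.2 hlt
  have hpm : 0 < pmin := by
    have : f ((k : ℝ) - 1) ≤ f k :=
      hmono ⟨by linarith, by linarith⟩ ⟨hk0.le, le_rfl⟩ (by linarith)
    unfold marginalCost at hhigh
    linarith
  set G : ℝ → ℝ := fun y => pmin * y - φ y with hG
  have hGc : Continuous G := by fun_prop
  have hGk : A ≤ G k := by simp only [hG, hA]; linarith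
  have hGpos : ∀ y ∈ Ioc (0 : ℝ) k, 0 < G y := by
    intro y hy
    rcases hy.2.eq_or_lt with rfl | hyk
    · exact hA0.trans_le hGk
    · simp only [hG, hφf ⟨hy.1, hyk⟩]; exact hpos y hy
  set Ψ : ℝ → ℝ := fun γ => A / (k * G γ) * (G k - G γ +
    A / (k * G γ) * ∫ y in γ..k, (G y - G γ) * Real.exp (A / (k * G γ) * (k - y))) with hΨ
  -- As f(a) ≥ 0, this gives G(a) ≤ pmin·a ≤ A²/(A + kD), which is exactly A/(k G(a)) · (A − G(a)) ≥
  -- D. The bound k/2 keeps a below k.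
  set a := min ((k : ℝ) / 2) (A ^ 2 / ((A + k * D) * pmin)) with ha
  have ha0 : 0 < a := by positivity
  have hak : a < k := (min_le_left _ _).trans_lt (by linarith)
  have hGa : G a = pmin * a - f a := by simp only [hG, hφf ⟨ha0, hak⟩]
  have hga : (A + k * D) * G a ≤ A ^ 2 := by
    have h1 : a * ((A + k * D) * pmin) ≤ A ^ 2 := by
      rw [← le_div_iff₀ (by positivity)]
      exact min_le_right _ _
    have h2 : 0 ≤ f a := hf0 ▸ hmono ⟨le_rfl, hk0.le⟩ ⟨ha0.le, hak.le⟩ ha0.le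
    rw [hGa]
    nlinarith [mul_nonneg (by positivity : 0 ≤ A + k * D) h2]
  have hGa0 : 0 < G a := hGpos a ⟨ha0, hak.le⟩
  have hgaA : G a ≤ A := by
    by_contra! hcon
    nlinarith [mul_pos (mul_pos hk0 hD0) hGa0]
  have hΨa : D ≤ Ψ a := by
    have hnn : 0 ≤ ∫ y in a..k, (G y - G a) * Real.exp (A / (k * G a) * (k - y)) :=
      integral_nonneg hak.le fun y hy => mul_nonneg (sub_nonneg.2
        (le_of_le_final hconv hφf hφk ⟨ha0, hak⟩ (hGa ▸ hgaA) y hy)) (Real.exp_pos _).le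
    have hl : 0 ≤ A / (k * G a) := by positivity
    calc D ≤ A / (k * G a) * (A - G a) := by
          rw [div_mul_eq_mul_div, le_div_iff₀ (by positivity)]
          linarith
      _ ≤ Ψ a := by
          simp only [hΨ]
          refine mul_le_mul_of_nonneg_left ?_ hl
          linarith [mul_nonneg hl hnn]
  have hΨk : Ψ k = 0 := by simp [hΨ]
  have hΨc : ContinuousOn Ψ (Icc a k) := by
    have hne : ∀ γ ∈ Icc a (k : ℝ), k * G γ ≠ 0 := fun γ hγ =>
      (mul_pos hk0 (hGpos γ ⟨ha0.trans_le hγ.1, hγ.2⟩)).ne'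
    have hl : ContinuousOn (fun γ => A / (k * G γ)) (Icc a k) :=
      continuousOn_const.div (by fun_prop) hne
    -- Joint continuity in the rate and the moving endpoint; the fixed endpoint k has to come first,
    -- hence the sign change below.
    have hpar : Continuous fun p : ℝ × ℝ =>
        ∫ y in (k : ℝ)..p.2, (G y - G p.2) * Real.exp (p.1 * (k - y)) :=
      intervalIntegral.continuous_parametric_intervalIntegral_of_continuous
        (f := fun (p : ℝ × ℝ) y => (G y - G p.2) * Real.exp (p.1 * (k - y)))
        (by unfold Function.uncurry; fun_prop) continuous_snd
    have hI : ContinuousOn (fun γ => ∫ y in γ..k,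
        (G y - G γ) * Real.exp (A / (k * G γ) * (k - y))) (Icc a k) := by
      have := (hpar.comp_continuousOn (hl.prodMk continuousOn_id)).neg
      refine this.congr fun γ _ => ?_
      exact integral_symm _ _
    exact hl.mul ((by fun_prop : ContinuousOn (fun γ => G k - G γ) (Icc a k)).add (hl.mul hI))
  obtain ⟨γ, hγ, hγΨ⟩ := intermediate_value_Icc' hak.le hΨc ⟨hΨk ▸ hD0.le, hΨa⟩
  have hγk : γ < k := lt_of_le_of_ne hγ.2 fun h => by
    rw [h, hΨk] at hγΨ
    exact hD0.ne hγΨ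
  have hγ' : γ ∈ Ioo (0 : ℝ) k := ⟨ha0.trans_le hγ.1, hγk⟩
  refine ⟨γ, (isGammaRoot_iff_continuous hconv hmono hφ hφf hG hγ' (lam := A / (k * G γ)) ?_).2
    hγΨ.symm⟩
  rw [lowerBoundF, div_div, hG, mul_comm]
  simp only [hφf hγ', hA]

theorem isGammaRoot_unique_of_lt (hk : 1 ≤ k) (hconv : ConvexOn ℝ (Icc (0 : ℝ) k) f)
    (hmono : MonotoneOn f (Icc (0 : ℝ) k)) (hf0 : f 0 = 0) (hp : pmin < pmax)
    (hhigh : marginalCost f k < pmin) {γ₁ γ₂ : ℝ} (h₁ : IsGammaRoot f pmin pmax k γ₁)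
    (h₂ : IsGammaRoot f pmin pmax k γ₂) : γ₂ ≤ γ₁ := by
  by_contra! hlt
  have hk0 : (0 : ℝ) < k := by exact_mod_cast hk
  have hne : ∀ {γ}, IsGammaRoot f pmin pmax k γ → γ ∈ Ioo (0 : ℝ) k := fun {γ} h =>
    ⟨h.1.1, lt_of_le_of_ne h.1.2 fun he =>
      hp.ne ((isGammaRoot_right_iff hk hconv hf0 hhigh).1 (he ▸ h))⟩
  have hγ₁ := hne h₁
  have hγ₂ := hne h₂
  have hpos := fun y hy => mul_sub_pos (y := y) hk hconv hf0 hhigh hy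
  have hA := hpos k ⟨hk0, le_rfl⟩
  have hg₁ := hpos γ₁ h₁.1
  have hg₂ := hpos γ₂ h₂.1
  obtain ⟨φ, hφ, hφf, -⟩ := exists_continuous_eqOn_Ioo hk0 hconv hmono
  obtain ⟨-, hint⟩ := intervalIntegrable_margin (pmin := pmin) hconv hmono hφ hφf hγ₁.1 hγ₁.2.le
  have e₁ := (isGammaRoot_iff_margin hconv hmono hγ₁ rfl).1 h₁
  have e₂ := (isGammaRoot_iff_margin hconv hmono hγ₂ rfl).1 h₂
  have hanti : AntitoneOn (margin f pmin) (Ioo 0 k) := by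
    intro x hx y hy hxy
    have := hconv.monotoneOn_rightDeriv (by rwa [interior_Icc]) (by rwa [interior_Icc]) hxy
    unfold margin
    linarith [this]
  set lam₁ := lowerBoundF f pmin k γ₁ / k with hlam₁
  set lam₂ := lowerBoundF f pmin k γ₂ / k with hlam₂
  have hl₁ : 0 < lam₁ := div_pos (div_pos hA hg₁) hk0
  have hl₂ : 0 < lam₂ := div_pos (div_pos hA hg₂) hk0
  have hI₂ : 0 < ∫ y in γ₂..k, margin f pmin y * Real.exp (lam₂ * (k - y)) := by
    by_contra! hcon
    linarith [mul_nonpos_of_nonneg_of_nonpos hl₂.le hcon]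
  -- A positive margin beyond γ₂ means that g still rises after γ₂; by concavity g(γ₁) < g(γ₂), so
  -- the rate at γ₁ is the larger one.
  obtain ⟨y₀, hy₀, hσy₀⟩ : ∃ y ∈ Ioo γ₂ (k : ℝ), 0 < margin f pmin y := by
    by_contra! hcon
    have : ∫ y in γ₂..k, margin f pmin y * Real.exp (lam₂ * (k - y)) ≤ ∫ _ in γ₂..k, (0 : ℝ) :=
      integral_mono_on_of_le_Ioo hγ₂.2.le
        ((hint.mono_set (by
          rw [uIcc_of_le hγ₂.2.le, uIcc_of_le hγ₁.2.le]
          exact Icc_subset_Icc_left hlt.le)).mul_continuousOn (by fun_prop))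
        intervalIntegrable_const
        fun y hy => mul_nonpos_of_nonpos_of_nonneg (hcon y hy) (Real.exp_pos _).le
    rw [intervalIntegral.integral_zero] at this
    linarith
  have hy₀' : y₀ ∈ Ioo (0 : ℝ) k := ⟨hγ₂.1.trans hy₀.1, hy₀.2⟩
  have hy₀i : y₀ ∈ interior (Icc (0 : ℝ) k) := by rwa [interior_Icc]
  have hslope := (hconv.slope_le_leftDeriv_of_mem_interior (Ioo_subset_Icc_self hγ₂) hy₀i
    hy₀.1).trans (hconv.leftDeriv_le_rightDeriv_of_mem_interior hy₀i)
  have hg₂y : pmin * γ₂ - f γ₂ < pmin * y₀ - f y₀ := by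
    unfold margin at hσy₀
    rw [slope_def_field, div_le_iff₀ (sub_pos.2 hy₀.1)] at hslope
    nlinarith [mul_pos hσy₀ (sub_pos.2 hy₀.1)]
  have hg₁₂ : pmin * γ₁ - f γ₁ < pmin * γ₂ - f γ₂ :=
    (concaveOn_mul_sub hconv).lt_of_lt_later (Ioo_subset_Icc_self hγ₁)
      (Ioo_subset_Icc_self hy₀') hlt hy₀.1 hg₂y
  have hl₂₁ : lam₂ < lam₁ := by
    rw [hlam₁, hlam₂]
    unfold lowerBoundF
    gcongr
  have hmono := tail_integral_mono hγ₁.1 hlt hγ₂.2 hl₂₁.le hanti hint hI₂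
  have := mul_lt_mul_of_pos_right hl₂₁ hI₂
  have := mul_le_mul_of_nonneg_left hmono hl₁.le
  linarith

/-- Now D = 0, while strict growth of g makes the integrated form of the equation positive at every
γ < k. -/
theorem isGammaRoot_eq_right (hk : 1 ≤ k) (hconv : ConvexOn ℝ (Icc (0 : ℝ) k) f)
    (hmono : MonotoneOn f (Icc (0 : ℝ) k)) (hf0 : f 0 = 0) (hp : pmin = pmax)
    (hhigh : marginalCost f k < pmin)
    (hstrict : StrictMonoOn (fun y => pmin * y - f y) (Icc (0 : ℝ) k)) {γ : ℝ}
    (h : IsGammaRoot f pmin pmax k γ) : γ = k := by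
  by_contra hne
  have hk0 : (0 : ℝ) < k := by exact_mod_cast hk
  have hγ : γ ∈ Ioo (0 : ℝ) k := ⟨h.1.1, lt_of_le_of_ne h.1.2 hne⟩
  obtain ⟨φ, hφ, hφf, hφk⟩ := exists_continuous_eqOn_Ioo hk0 hconv hmono
  have hpos := fun y hy => mul_sub_pos (y := y) hk hconv hf0 hhigh hy
  have e := (isGammaRoot_iff_continuous hconv hmono hφ hφf rfl hγ rfl).1 h
  have hlt := hstrict (Ioo_subset_Icc_self hγ) (right_mem_Icc.2 hk0.le) hγ.2
  simp only at hlt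
  set lam := lowerBoundF f pmin k γ / k with hlam
  have hl : 0 < lam := div_pos (div_pos (hpos k ⟨hk0, le_rfl⟩) (hpos γ h.1)) hk0
  have hnn : 0 ≤ ∫ y in γ..k, (pmin * y - φ y - (pmin * γ - φ γ)) * Real.exp (lam * (k - y)) :=
    integral_nonneg hγ.2.le fun y hy => mul_nonneg (sub_nonneg.2
      (le_of_le_final hconv hφf hφk hγ hlt.le y hy)) (Real.exp_pos _).le
  rw [hφf hγ] at hnn e
  have := mul_pos hl (add_pos_of_pos_of_nonneg
    (show 0 < pmin * k - φ k - (pmin * γ - f γ) by linarith) (mul_nonneg hl.le hnn))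
  linarith

end CharacteristicEquation

/-! ### Online algorithms on the rising instance -/

section Online

/-- The revenue above the floor price `pmin` collected from `I` by a decision rule. -/
noncomputable def excessRevenue (accept : List ℝ → Bool) (pmin : ℝ) (I : List ℝ) : ℝ :=
  ∑ t ∈ selectedBy accept I, (I.get t - pmin)

theorem sum_selectedBy_append (accept : List ℝ → Bool) (φ : ℝ → ℝ) (I : List ℝ) (p : ℝ) :
    ∑ t ∈ selectedBy accept (I ++ [p]), φ ((I ++ [p]).get t)
      = ∑ t ∈ selectedBy accept I, φ (I.get t) + if accept (I ++ [p]) then φ p else 0 := by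
  -- Indexing by natural numbers makes sums over lists of different lengths comparable; earlier
  -- decisions see only prefixes, which appending does not change.
  have key : ∀ J : List ℝ, ∑ t ∈ selectedBy accept J, φ (J.get t)
      = ∑ i ∈ Finset.range J.length,
          if accept (J.take (i + 1)) then φ (J.getD i 0) else 0 := by
    intro J
    rw [Finset.sum_range, selectedBy, Finset.sum_filter]
    refine Finset.sum_congr rfl fun t _ => ?_
    simp
  rw [key, key, List.length_append, List.length_singleton, Finset.sum_range_succ]
  congr 1
  · refine Finset.sum_congr rfl fun i hi => ?_
    have hi := Finset.mem_range.1 hi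
    rw [List.take_append_of_le_length (by omega), List.getD_append _ _ _ _ hi]
  · rw [List.take_of_length_le (by simp)]
    simp

theorem card_selectedBy_append (accept : List ℝ → Bool) (I : List ℝ) (p : ℝ) :
    (selectedBy accept (I ++ [p])).card
      = (selectedBy accept I).card + if accept (I ++ [p]) then 1 else 0 := by
  have := sum_selectedBy_append accept (fun _ => 1) I p
  simp only [Finset.sum_const, nsmul_eq_mul, mul_one] at this
  exact_mod_cast this

theorem excessRevenue_append (accept : List ℝ → Bool) (pmin : ℝ) (I : List ℝ) (p : ℝ) :
    excessRevenue accept pmin (I ++ [p])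
      = excessRevenue accept pmin I + if accept (I ++ [p]) then p - pmin else 0 :=
  sum_selectedBy_append accept (fun x => x - pmin) I p

theorem card_selectedBy_le_append (accept : List ℝ → Bool) (I : List ℝ) (p : ℝ) (n : ℕ) :
    (selectedBy accept I).card ≤ (selectedBy accept (I ++ List.replicate n p)).card := by
  induction n with
  | zero => rw [List.replicate_zero, List.append_nil]
  | succ n ih =>
    rw [List.replicate_succ', ← List.append_assoc, card_selectedBy_append]
    exact ih.trans (Nat.le_add_right _ _)

theorem excessRevenue_append_replicate (accept : List ℝ → Bool) (pmin : ℝ) (I : List ℝ) (p : ℝ)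
    (n : ℕ) : excessRevenue accept pmin (I ++ List.replicate n p)
      = excessRevenue accept pmin I + (p - pmin) *
        (((selectedBy accept (I ++ List.replicate n p)).card : ℝ) - (selectedBy accept I).card) := by
  induction n with
  | zero => rw [List.replicate_zero, List.append_nil, sub_self, mul_zero, add_zero]
  | succ n ih =>
    rw [List.replicate_succ', ← List.append_assoc, card_selectedBy_append, excessRevenue_append, ih]
    split_ifs <;> push_cast <;> ring

theorem profit_selectedBy (f : ℝ → ℝ) (accept : List ℝ → Bool) (pmin : ℝ) (I : List ℝ) :
    profit f I (selectedBy accept I) = excessRevenue accept pmin I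
      + (pmin * (selectedBy accept I).card - f (selectedBy accept I).card) := by
  unfold profit excessRevenue
  rw [Finset.sum_sub_distrib, Finset.sum_const, nsmul_eq_mul]
  ring

/-- Selecting the last `k` of the buyers, who all offer `p`. -/
theorem le_offlineOpt_append_replicate (f : ℝ → ℝ) (k : ℕ) (I : List ℝ) (p : ℝ) :
    p * k - f k ≤ offlineOpt f k (I ++ List.replicate k p) := by
  -- The offline selection is encoded as the rule accepting everything after `I`, so that the append
  -- lemmas count it. Measuring excess over p itself makes the excess revenue 0.
  set accept : List ℝ → Bool := fun h => decide (I.length < h.length) with hacc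
  have h0 : (selectedBy accept I).card = 0 := by
    rw [Finset.card_eq_zero, selectedBy, Finset.filter_eq_empty_iff]
    intro t _
    simp [hacc]
  have hc : ∀ n, (selectedBy accept (I ++ List.replicate n p)).card = n := by
    intro n
    induction n with
    | zero => rw [List.replicate_zero, List.append_nil, h0]
    | succ n ih =>
      rw [List.replicate_succ', ← List.append_assoc, card_selectedBy_append, ih, if_pos]
      simp [hacc]
  have hr : excessRevenue accept p I = 0 := by
    rw [excessRevenue, Finset.card_eq_zero.1 h0, Finset.sum_empty]
  have hprofit := profit_selectedBy f accept p (I ++ List.replicate k p)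
  rw [excessRevenue_append_replicate, hr, hc] at hprofit
  refine le_of_eq_of_le ?_ (Finset.le_sup' _
    (show selectedBy accept (I ++ List.replicate k p) ∈ feasible k _ by simp [feasible, hc]))
  rw [hprofit]
  ring

variable {Ω : Type*} [MeasurableSpace Ω] {k : ℕ} {pmin pmax : ℝ}

/-- On a fixed instance the selection is a function of finitely many measurable Boolean decisions,
so it takes finitely many values. -/
theorem RandomizedAlgorithm.integrable_selectedBy (A : RandomizedAlgorithm Ω k pmin pmax)
    (μ : Measure Ω) [IsFiniteMeasure μ] (I : List ℝ) (φ : Finset (Fin I.length) → ℝ) :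
    Integrable (fun ω => φ (selectedBy (A.alg ω).accept I)) μ := by
  set X : Ω → Fin I.length → Bool := fun ω t => (A.alg ω).accept (I.take (t.val + 1)) with hX
  have hXm : Measurable X := measurable_pi_lambda _ fun t => A.measurable_accept _
  set ψ : (Fin I.length → Bool) → ℝ := fun x => φ (Finset.univ.filter fun t => x t = true) with hψ
  have hψm : Measurable ψ := measurable_of_finite _
  have hm : Measurable (fun ω => φ (selectedBy (A.alg ω).accept I)) := hψm.comp hXm
  obtain ⟨C, hC⟩ := (Set.finite_range fun S => ‖φ S‖).bddAbove
  exact Integrable.of_bound hm.aestronglyMeasurable C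
    (Filter.Eventually.of_forall fun ω => hC ⟨_, rfl⟩)

/-- The rising instance: `k` buyers at each of the prices `pmin + δ i`, `i ≤ j`. -/
def risingInstance (k : ℕ) (pmin δ : ℝ) : ℕ → List ℝ
  | 0 => List.replicate k pmin
  | j + 1 => risingInstance k pmin δ j ++ List.replicate k (pmin + δ * (j + 1 : ℕ))

theorem isInstance_risingInstance {δ : ℝ} (hδ : 0 ≤ δ) :
    ∀ {j : ℕ}, pmin + δ * j ≤ pmax → IsInstance pmin pmax (risingInstance k pmin δ j)
  | 0, h, p, hp => by
    obtain rfl := List.eq_of_mem_replicate hp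
    exact ⟨le_rfl, by simpa using h⟩
  | j + 1, h, p, hp => by
    rcases List.mem_append.1 hp with hp | hp
    · refine isInstance_risingInstance hδ (le_trans ?_ h) p hp
      gcongr
      exact Nat.le_succ j
    · obtain rfl := List.eq_of_mem_replicate hp
      exact ⟨le_add_of_nonneg_right (by positivity), h⟩

theorem le_offlineOpt_risingInstance (f : ℝ → ℝ) (δ : ℝ) (j : ℕ) :
    (pmin + δ * j) * k - f k ≤ offlineOpt f k (risingInstance k pmin δ j) := by
  cases j with
  | zero => simpa [risingInstance] using le_offlineOpt_append_replicate f k [] pmin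
  | succ j => exact le_offlineOpt_append_replicate f k _ _

/-- Expected sales `w` and expected excess revenue `R` of an algorithm along the rising instance. -/
theorem RandomizedAlgorithm.rising_constraints {f : ℝ → ℝ} (hk : 1 ≤ k)
    (hconv : ConvexOn ℝ (Set.Icc (0 : ℝ) k) f) (A : RandomizedAlgorithm Ω k pmin pmax)
    (μ : Measure Ω) [IsProbabilityMeasure μ] {α δ : ℝ} (hA : A.IsCompetitive μ f α) (hα : 0 ≤ α)
    (hδ : 0 ≤ δ) {n : ℕ} (hn : pmin + δ * n ≤ pmax) :
    ∃ w R : ℕ → ℝ, 0 ≤ w 0 ∧ Monotone w ∧ w n ≤ k ∧ R 0 = 0 ∧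
      (∀ j, R (j + 1) = R j + δ * (j + 1 : ℕ) * (w (j + 1) - w j)) ∧
      ∀ j ≤ n, (pmin + δ * j) * k - f k
        ≤ α * (R j + chordMin (fun y => pmin * y - f y) k hk (w j)) := by
  set I := risingInstance k pmin δ with hI
  set N : ℕ → Ω → ℕ := fun j ω => (selectedBy (A.alg ω).accept (I j)).card with hN
  set r : ℕ → Ω → ℝ := fun j ω => excessRevenue (A.alg ω).accept pmin (I j) with hr
  have hNi : ∀ j, Integrable (fun ω => (N j ω : ℝ)) μ := fun j =>
    A.integrable_selectedBy μ (I j) fun S => (S.card : ℝ)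
  have hgi : ∀ j, Integrable (fun ω => pmin * (N j ω : ℝ) - f (N j ω)) μ := fun j =>
    A.integrable_selectedBy μ (I j) fun S => pmin * (S.card : ℝ) - f S.card
  have hri : ∀ j, Integrable (r j) μ := fun j =>
    A.integrable_selectedBy μ (I j) fun S => ∑ t ∈ S, ((I j).get t - pmin)
  have hinst : ∀ j ≤ n, IsInstance pmin pmax (I j) := fun j hj =>
    isInstance_risingInstance hδ (le_trans (by gcongr) hn)
  have hNk : ∀ j ≤ n, ∀ ω, N j ω ≤ k := fun j hj ω => (A.alg ω).capacity _ (hinst j hj)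
  refine ⟨fun j => ∫ ω, (N j ω : ℝ) ∂μ, fun j => ∫ ω, r j ω ∂μ,
    integral_nonneg fun ω => by positivity, monotone_nat_of_le_succ fun j => ?_, ?_, ?_,
    fun j => ?_, fun j hj => ?_⟩
  · exact integral_mono (hNi j) (hNi (j + 1)) fun ω =>
      Nat.cast_le.2 (card_selectedBy_le_append _ _ _ _)
  · calc ∫ ω, (N n ω : ℝ) ∂μ ≤ ∫ _, (k : ℝ) ∂μ :=
          integral_mono (hNi n) (integrable_const _) fun ω => Nat.cast_le.2 (hNk n le_rfl ω)
      _ = k := by simp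
  · have : ∀ ω, r 0 ω = 0 := fun ω => by
      have h := excessRevenue_append_replicate (A.alg ω).accept pmin [] pmin k
      simp only [List.nil_append, sub_self, zero_mul, add_zero] at h
      simp only [hr, hI, risingInstance, h]
      exact Finset.sum_eq_zero fun t _ => Fin.elim0 t
    simp [this]
  · have : ∀ ω, r (j + 1) ω
        = r j ω + δ * (j + 1 : ℕ) * ((N (j + 1) ω : ℝ) - N j ω) := fun ω => by
      have h := excessRevenue_append_replicate (A.alg ω).accept pmin (I j)
        (pmin + δ * (j + 1 : ℕ)) k
      rwa [add_sub_cancel_left] at h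
    have hs : Integrable (fun ω => (N (j + 1) ω : ℝ) - N j ω) μ := (hNi (j + 1)).sub (hNi j)
    simp only [this]
    rw [integral_add (hri j) (hs.const_mul _), integral_const_mul, integral_sub (hNi _) (hNi j)]
  · have hJ := integral_le_chordMin hk (concaveOn_mul_sub (pmin := pmin) hconv) μ (N j) (hNk j hj)
      (hNi j) (hgi j)
    have hE : A.expectedProfit μ f (I j)
        = ∫ ω, r j ω ∂μ + ∫ ω, (pmin * (N j ω : ℝ) - f (N j ω)) ∂μ := by
      rw [← integral_add (hri j) (hgi j)]
      exact integral_congr_ae (Filter.Eventually.of_forall fun ω => profit_selectedBy f _ pmin _)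
    calc (pmin + δ * j) * k - f k ≤ offlineOpt f k (I j) := le_offlineOpt_risingInstance f δ j
      _ ≤ α * A.expectedProfit μ f (I j) := hA _ (hinst j hj)
      _ ≤ _ := by
          rw [hE]
          gcongr

end Online

/-! ### Lower bound on the competitive ratio -/

section LowerBound

open intervalIntegral Filter Topology

variable {Ω : Type*} [MeasurableSpace Ω] {k : ℕ} {pmin pmax : ℝ} {f : ℝ → ℝ}

theorem chordMin_nonneg (hk : 1 ≤ k) (hconv : ConvexOn ℝ (Set.Icc (0 : ℝ) k) f) (hf0 : f 0 = 0)
    (hhigh : marginalCost f k < pmin) {y : ℝ} (hy : 0 ≤ y) :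
    0 ≤ chordMin (fun y => pmin * y - f y) k hk y := by
  have hg := concaveOn_mul_sub (pmin := pmin) hconv
  have h := le_chordMin hk hg (Nat.zero_le k)
  simp only [Nat.cast_zero, mul_zero, hf0, sub_zero] at h
  exact h.trans (monotone_chordMin hk hg (last_increment_pos hhigh) hy)

/-- No algorithm beats the offline optimum. -/
theorem RandomizedAlgorithm.one_le_of_isCompetitive (hk : 1 ≤ k)
    (hconv : ConvexOn ℝ (Set.Icc (0 : ℝ) k) f) (hf0 : f 0 = 0) (hp : pmin ≤ pmax)
    (hhigh : marginalCost f k < pmin) (A : RandomizedAlgorithm Ω k pmin pmax) (μ : Measure Ω)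
    [IsProbabilityMeasure μ] {α : ℝ} (hA : A.IsCompetitive μ f α) : 1 ≤ α := by
  have hg := concaveOn_mul_sub (pmin := pmin) hconv
  have hk0 : (0 : ℝ) < k := by exact_mod_cast hk
  have hpos : 0 < pmin * k - f k := mul_sub_pos hk hconv hf0 hhigh ⟨hk0, le_rfl⟩
  set I := [] ++ List.replicate k pmin with hI
  have hinst : IsInstance pmin pmax I := fun p h => by
    obtain rfl := List.eq_of_mem_replicate (by simpa [hI] using h)
    exact ⟨le_rfl, hp⟩
  have hprofit : ∀ ω, 0 ≤ profit f I (selectedBy (A.alg ω).accept I) ∧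
      profit f I (selectedBy (A.alg ω).accept I) ≤ pmin * k - f k := by
    intro ω
    have hcap := (A.alg ω).capacity I hinst
    rw [profit_selectedBy f _ pmin, hI, excessRevenue_append_replicate, sub_self, zero_mul,
      add_zero, ← hI]
    have h0 : excessRevenue (A.alg ω).accept pmin [] = 0 :=
      Finset.sum_eq_zero fun t _ => Fin.elim0 t
    rw [h0, zero_add]
    set n := (selectedBy (A.alg ω).accept I).card with hn
    constructor
    · rcases Nat.eq_zero_or_pos n with h | h
      · simp [h, hf0]
      · exact (mul_sub_pos hk hconv hf0 hhigh
          ⟨by exact_mod_cast h, by exact_mod_cast hcap⟩).le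
    -- g need not be monotone, so the comparison goes through its increasing interpolation.
    · exact (le_chordMin hk hg hcap).trans
        ((monotone_chordMin hk hg (last_increment_pos hhigh) (by exact_mod_cast hcap)).trans
          (chordMin_le hk hg (natCast_mem_Icc le_rfl)))
  have hE0 : 0 ≤ A.expectedProfit μ f I := integral_nonneg fun ω => (hprofit ω).1
  have hE1 : A.expectedProfit μ f I ≤ pmin * k - f k :=
    calc A.expectedProfit μ f I ≤ ∫ _, (pmin * k - f k) ∂μ :=
          integral_mono (A.integrable_selectedBy μ I (profit f I)) (integrable_const _)
            fun ω => (hprofit ω).2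
      _ = pmin * k - f k := by simp
  have hcomp := (le_offlineOpt_append_replicate f k [] pmin).trans (hA I hinst)
  by_contra! hlt
  rcases le_or_gt α 0 with hα | hα
  · nlinarith [mul_nonneg (neg_nonneg.2 hα) hE0]
  · nlinarith [mul_le_mul_of_nonneg_left hE1 hα.le, mul_pos (sub_pos.2 hlt) hpos]

/-- The price range that an `α`-competitive algorithm can cope with. -/
theorem RandomizedAlgorithm.price_range_le (hk : 1 ≤ k)
    (hconv : ConvexOn ℝ (Set.Icc (0 : ℝ) k) f) (hp : pmin ≤ pmax)
    (hhigh : marginalCost f k < pmin) (A : RandomizedAlgorithm Ω k pmin pmax) (μ : Measure Ω)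
    [IsProbabilityMeasure μ] {lam : ℝ} (hlam : 0 < lam) (hA : A.IsCompetitive μ f (lam * k)) :
    pmax - pmin ≤ lam * (pmin * k - f k) - (pmin * k - f k) / k
      + lam * ∫ y in (0 : ℝ)..k, Real.exp (lam * (k - y)) *
          max (lam * chordMin (fun y => pmin * y - f y) k hk y - (pmin * k - f k) / k) 0 := by
  have hg := concaveOn_mul_sub (pmin := pmin) hconv
  have hk0 : (0 : ℝ) < k := by exact_mod_cast hk
  set c := (pmin * k - f k) / k with hc
  set G := chordMin (fun y => pmin * y - f y) k hk with hG
  have hGc : Continuous G := continuous_chordMin hk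
  have hGm : Monotone G := monotone_chordMin hk hg (last_increment_pos hhigh)
  have hGk : G k ≤ pmin * k - f k := chordMin_le hk hg (natCast_mem_Icc le_rfl)
  set D := pmax - pmin with hD
  have hD0 : 0 ≤ D := sub_nonneg.2 hp
  set J := ∫ y in (0 : ℝ)..k, Real.exp (-lam * y) * max (lam * G y - c) 0 with hJ
  set C := ∫ y in (0 : ℝ)..k, Real.exp (-lam * y) with hC
  have hJe : ∫ y in (0 : ℝ)..k, Real.exp (lam * (k - y)) * max (lam * G y - c) 0
      = Real.exp (lam * k) * J := by
    rw [hJ, ← intervalIntegral.integral_const_mul]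
    congr 1
    ext y
    rw [show lam * (k - y) = lam * k + -lam * y by ring, Real.exp_add, mul_assoc]
  rw [hJe]
  -- The mesh is D/(n + 1), so that the last price is exactly pmax; its error term vanishes as n →
  -- ∞.
  have hstep : ∀ n : ℕ, D ≤ lam * (pmin * k - f k) - c
      + lam * (Real.exp (lam * k) * (J + D / (n + 1 : ℕ) * C)) := by
    intro n
    set δ := D / (n + 1 : ℕ) with hδ
    have hδ0 : 0 ≤ δ := by positivity
    have hδn : δ * (n + 1 : ℕ) = D := div_mul_cancel₀ _ (by positivity)
    obtain ⟨w, R, hw0, hw, hwk, hR0, hR, hcon⟩ := A.rising_constraints hk hconv μ hA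
      (by positivity) hδ0 (n := n + 1) (by rw [hδn, hD]; linarith)
    have hq : ∀ j ≤ n + 1, c + δ * j ≤ lam * (R j + G (w j)) := by
      intro j hj
      have h := hcon j hj
      have h' : c + δ * j = ((pmin + δ * j) * k - f k) / k := by rw [hc]; field_simp; ring
      rw [h', div_le_iff₀ hk0]
      linarith
    have hgron := exp_mul_le_integral_of_discrete hlam hδ0 hGc hGm hw0 hw hR0 hR
      (fun j hj => hq j hj.le) (n + 1) le_rfl
    have hint : ∀ a b, IntervalIntegrable
        (fun y => Real.exp (-lam * y) * (max (lam * G y - c) 0 + δ)) volume a b :=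
      fun a b => Continuous.intervalIntegrable (by fun_prop) a b
    have hwn0 : 0 ≤ w (n + 1) := hw0.trans (hw (Nat.zero_le _))
    have htail : 0 ≤ ∫ y in w (n + 1)..k, Real.exp (-lam * y) * (max (lam * G y - c) 0 + δ) :=
      integral_nonneg hwk fun y _ => by positivity
    have hfull : ∫ y in (0 : ℝ)..k, Real.exp (-lam * y) * (max (lam * G y - c) 0 + δ)
        = J + δ * C := by
      rw [hJ, hC, ← intervalIntegral.integral_const_mul, ← intervalIntegral.integral_add
        (Continuous.intervalIntegrable (by fun_prop) _ _)
        (Continuous.intervalIntegrable (by fun_prop) _ _)]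
      congr 1
      ext y
      ring
    rw [← integral_add_adjacent_intervals (hint 0 (w (n + 1))) (hint _ k)] at hfull
    have hRn : R (n + 1) ≤ Real.exp (lam * k) * (J + δ * C) := by
      have h0 : 0 ≤ J + δ * C := by
        rw [← hfull]
        exact add_nonneg (integral_nonneg hwn0 fun y _ => by positivity) htail
      calc R (n + 1) = Real.exp (lam * w (n + 1)) * (Real.exp (-lam * w (n + 1)) * R (n + 1)) := by
            rw [← mul_assoc, ← Real.exp_add]; simp
        _ ≤ Real.exp (lam * w (n + 1)) * (J + δ * C) := by gcongr; linarith
        _ ≤ Real.exp (lam * k) * (J + δ * C) := by gcongr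
    have hlast := hq (n + 1) le_rfl
    rw [hδn] at hlast
    have h1 : lam * R (n + 1) ≤ lam * (Real.exp (lam * k) * (J + δ * C)) := by gcongr
    have h2 : lam * G (w (n + 1)) ≤ lam * (pmin * k - f k) := by
      gcongr
      exact (hGm hwk).trans hGk
    linarith
  have hlim : Tendsto (fun n : ℕ => lam * (pmin * k - f k) - c
      + lam * (Real.exp (lam * k) * (J + D / (n + 1 : ℕ) * C))) atTop
      (𝓝 (lam * (pmin * k - f k) - c + lam * (Real.exp (lam * k) * (J + 0 * C)))) := by
    have := (tendsto_const_div_atTop_nhds_zero_nat D).comp (tendsto_add_atTop_nat 1)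
    exact ((((this.mul_const C).const_add J).const_mul _).const_mul _).const_add _
  simpa using ge_of_tendsto' hlim hstep

theorem RandomizedAlgorithm.not_isCompetitive_of_isGammaRoot (hk : 1 ≤ k)
    (hconv : ConvexOn ℝ (Set.Icc (0 : ℝ) k) f) (hmono : MonotoneOn f (Set.Icc (0 : ℝ) k))
    (hf0 : f 0 = 0) (hp : pmin ≤ pmax) (hhigh : marginalCost f k < pmin) {γ : ℝ}
    (hroot : IsGammaRoot f pmin pmax k γ) {ε : ℝ} (hε : 0 < ε) (μ : Measure Ω)
    [IsProbabilityMeasure μ] (A : RandomizedAlgorithm Ω k pmin pmax) :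
    ¬ A.IsCompetitive μ f (lowerBoundF f pmin k γ - ε) := by
  intro hA
  have hg := concaveOn_mul_sub (pmin := pmin) hconv
  have hk0 : (0 : ℝ) < k := by exact_mod_cast hk
  have hone := A.one_le_of_isCompetitive hk hconv hf0 hp hhigh μ hA
  have hposk := mul_sub_pos hk hconv hf0 hhigh ⟨hk0, le_rfl⟩
  have hposγ := mul_sub_pos hk hconv hf0 hhigh hroot.1
  -- No ratio below 1 is attainable, so F(γ) ≥ 1 + ε. This excludes γ = k and yields g(γ) ≤ g(k).
  have hγ : γ ∈ Set.Ioo (0 : ℝ) k := ⟨hroot.1.1, lt_of_le_of_ne hroot.1.2 fun h => by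
    rw [h, lowerBoundF_right hk hconv hf0 hhigh] at hone
    linarith⟩
  have hle : pmin * γ - f γ ≤ pmin * k - f k := by
    have : 1 ≤ lowerBoundF f pmin k γ := by linarith
    rwa [lowerBoundF, one_le_div hposγ] at this
  obtain ⟨φ, hφ, hφf, hφk⟩ := exists_continuous_eqOn_Ioo hk0 hconv hmono
  set H : ℝ → ℝ := fun y => pmin * y - φ y with hH
  have hHc : Continuous H := by fun_prop
  have hHγ : H γ = pmin * γ - f γ := by simp only [hH, hφf hγ]
  have hHk : pmin * k - f k ≤ H k := by simp only [hH]; linarith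
  have hHle : ∀ y ∈ Set.Icc γ (k : ℝ), H γ ≤ H y := le_of_le_final hconv hφf hφk hγ hle
  set ν := lowerBoundF f pmin k γ / k with hν
  have hD := (isGammaRoot_iff_continuous hconv hmono hφ hφf hH hγ hν).1 hroot
  have hνc : ν * H γ = (pmin * k - f k) / k := by
    rw [hν, hHγ, lowerBoundF]
    field_simp
  set lam := (lowerBoundF f pmin k γ - ε) / k with hlam
  have hlam0 : 0 < lam := div_pos (by linarith) hk0
  have hlamν : lam < ν := by rw [hlam, hν]; gcongr; linarith
  have hν0 : 0 < ν := hlam0.trans hlamν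
  have hrange := A.price_range_le hk hconv hp hhigh μ hlam0
    (by rwa [hlam, div_mul_cancel₀ _ hk0.ne'])
  set c := (pmin * k - f k) / k with hc
  set G := chordMin (fun y => pmin * y - f y) k hk with hG
  have hGc : Continuous G := continuous_chordMin hk
  have hGm : Monotone G := monotone_chordMin hk hg (last_increment_pos hhigh)
  have hGH : ∀ y ∈ Set.Icc γ (k : ℝ), G y ≤ H y := by
    intro y hy
    refine (chordMin_le hk hg ⟨hγ.1.le.trans hy.1, hy.2⟩).trans ?_
    rcases hy.2.eq_or_lt with rfl | hyk
    · exact hHk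
    · simp only [hH, hφf ⟨hγ.1.trans_le hy.1, hyk⟩, le_refl]
  have hint : ∀ a b, IntervalIntegrable
      (fun y => Real.exp (ν * (k - y)) * max (ν * G y - c) 0) volume a b :=
    fun a b => Continuous.intervalIntegrable (by fun_prop) a b
  have hmonoI : ∫ y in (0 : ℝ)..k, Real.exp (lam * (k - y)) * max (lam * G y - c) 0
      ≤ ∫ y in (0 : ℝ)..k, Real.exp (ν * (k - y)) * max (ν * G y - c) 0 := by
    refine integral_mono_on hk0.le (Continuous.intervalIntegrable (by fun_prop) _ _) (hint _ _)
      fun y hy => ?_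
    have h1 : 0 ≤ (k : ℝ) - y := sub_nonneg.2 hy.2
    have h2 : 0 ≤ G y := chordMin_nonneg hk hconv hf0 hhigh hy.1
    gcongr
  have hI0 : ∫ y in (0 : ℝ)..γ, Real.exp (ν * (k - y)) * max (ν * G y - c) 0 ≤ 0 := by
    have : ∫ y in (0 : ℝ)..γ, Real.exp (ν * (k - y)) * max (ν * G y - c) 0
        ≤ ∫ _ in (0 : ℝ)..γ, (0 : ℝ) := by
      refine integral_mono_on hγ.1.le (hint _ _) intervalIntegrable_const fun y hy => ?_
      -- Before γ the increasing G is at most g(γ), and ν·g(γ) = c.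
      have hy' : ν * G y ≤ c := by
        rw [← hνc]
        gcongr
        exact (hGm hy.2).trans (hGH γ ⟨le_rfl, hγ.2.le⟩)
      rw [max_eq_right (by linarith), mul_zero]
    simpa using this
  have hI1 : ∫ y in γ..k, Real.exp (ν * (k - y)) * max (ν * G y - c) 0
      ≤ ν * ∫ y in γ..k, (H y - H γ) * Real.exp (ν * (k - y)) := by
    rw [← intervalIntegral.integral_const_mul]
    refine integral_mono_on hγ.2.le (hint _ _) (Continuous.intervalIntegrable (by fun_prop) _ _)
      fun y hy => ?_
    have h1 : max (ν * G y - c) 0 ≤ ν * (H y - H γ) := by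
      refine max_le ?_ (mul_nonneg hν0.le (sub_nonneg.2 (hHle y hy)))
      have := mul_le_mul_of_nonneg_left (hGH y hy) hν0.le
      linarith
    calc Real.exp (ν * (k - y)) * max (ν * G y - c) 0
        ≤ Real.exp (ν * (k - y)) * (ν * (H y - H γ)) := by gcongr
      _ = _ := by ring
  have hIsum := integral_add_adjacent_intervals (hint 0 γ) (hint γ k)
  have hnn : 0 ≤ ∫ y in (0 : ℝ)..k, Real.exp (ν * (k - y)) * max (ν * G y - c) 0 :=
    integral_nonneg hk0.le fun y _ => by positivity
  have e1 := mul_le_mul_of_nonneg_left hmonoI hlam0.le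
  have e2 := mul_le_mul_of_nonneg_right hlamν.le hnn
  have e3 := mul_le_mul_of_nonneg_left (hIsum.symm.le.trans (add_le_add hI0 hI1)) hν0.le
  -- The only strict inequality: the term λA grows strictly because A > 0.
  have e4 := mul_lt_mul_of_pos_right hlamν hposk
  have e5 := mul_le_mul_of_nonneg_left hHk hν0.le
  linarith

end LowerBound

theorem corollary2 (k : ℕ) (hk : 1 ≤ k) (f : ℝ → ℝ)
    (hconv : ConvexOn ℝ (Set.Icc (0 : ℝ) k) f) (hmono : MonotoneOn f (Set.Icc (0 : ℝ) k))
    (hf0 : f 0 = 0) (pmin pmax : ℝ) (hp : pmin ≤ pmax) (hhigh : marginalCost f k < pmin) :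
    (∃ γ : ℝ, IsGammaRoot f pmin pmax k γ) ∧
    ((pmin < pmax ∨ StrictMonoOn (fun y => pmin * y - f y) (Set.Icc (0 : ℝ) k)) →
      ∃! γ : ℝ, IsGammaRoot f pmin pmax k γ) ∧
    (∀ γ : ℝ, IsGammaRoot f pmin pmax k γ → ∀ ε : ℝ, 0 < ε →
      ∀ (Ω : Type*) [MeasurableSpace Ω] (μ : Measure Ω) [IsProbabilityMeasure μ]
        (A : RandomizedAlgorithm Ω k pmin pmax),
        ¬ A.IsCompetitive μ f (lowerBoundF f pmin k γ - ε)) := by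
  obtain ⟨γ, hγ⟩ := exists_isGammaRoot hk hconv hmono hf0 hp hhigh
  refine ⟨⟨γ, hγ⟩, fun h => ⟨γ, hγ, fun γ' hγ' => ?_⟩, fun γ' hγ' ε hε Ω _ μ _ A =>
    A.not_isCompetitive_of_isGammaRoot hk hconv hmono hf0 hp hhigh hγ' hε μ⟩
  rcases hp.lt_or_eq with hlt | heq
  · exact le_antisymm (isGammaRoot_unique_of_lt hk hconv hmono hf0 hlt hhigh hγ hγ')
      (isGammaRoot_unique_of_lt hk hconv hmono hf0 hlt hhigh hγ' hγ)
  · have hstrict := h.resolve_left heq.not_lt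
    rw [isGammaRoot_eq_right hk hconv hmono hf0 heq hhigh hstrict hγ,
      isGammaRoot_eq_right hk hconv hmono hf0 heq hhigh hstrict hγ']
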